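/- Let $-\infty < a < b < +\infty$. For a function $f : \,]a,b[\, \to \mathbb{R}$ let $T_f\,]a,b[ \;\in [0,+\infty]$ be the supremum of the total variations of $f$ in the closed subintervals of $]a,b[$, and let $BV\,]a,b[$ be the set of those $f$ for which $T_f\,]a,b[ \;<+\infty$. Let $BVL^1\,]a,b[$ be the set of those integrable $f : \,]a,b[\, \to \mathbb{R}$ for which there is a finite signed Radon measure $Df$ in $]a,b[$ with $$\int_{]a,b[} f \phi' \, dx = - \int_{]a,b[} \phi \, dDf \qquad (\forall\, \phi \in C_c^\infty\,]a,b[).$$ For a subset $M \subset \,]a,b[$ of Lebesgue measure $0$ let $f_M$ be the restriction of $f$ to $]a,b[\, - M$ and let $T_{f_M}\,]a,b[$ be the supremum of the sums $\sum_{i=1}^n |f(x_i) - f(x_{i-1})|$ over all finite sequences $x_0 < x_1 < \cdots < x_n$ of points of $]a,b[\, - M$. Let $f \in BVL^1\,]a,b[$. Then the essential variation of $f$ equals Cesari's quantity $\varphi(f)$: $$\inf \{ T_g\,]a,b[ \;:\; g : \,]a,b[\, \to \mathbb{R},\ g = f \text{ almost everywhere}\} \;=\; \varphi(f) \;:=\;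 \inf \{ T_{f_M}\,]a,b[ \;:\; M \subset \,]a,b[ \text{ of Lebesgue measure } 0\}.$$ Moreover, there exists a $g \in BV\,]a,b[$ which is equal to $f$ almost everywhere in $]a,b[$ and satisfies $T_g\,]a,b[ \;= \varphi(f)$. -/

import Mathlib

open MeasureTheory Set
open scoped ENNReal ContDiff

/-! Functions on the open interval `]a,b[` are represented by functions `ℝ → ℝ`; every notion
below depends only on the values on `Ioo a b`. -/

/-- The total variation `T_f ]a,b[`: the supremum of the total variations of `f` in the closed
subintervals `[c,d]` of `]a,b[`. -/
noncomputable def openTotalVariation (f : ℝ → ℝ) (a b : ℝ) : ℝ≥0∞ :=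
  ⨆ (c : ℝ) (d : ℝ) (_ : a < c) (_ : c < d) (_ : d < b), eVariationOn f (Icc c d)

/-- `f ∈ BV ]a,b[`. -/
def MemBVOpen (f : ℝ → ℝ) (a b : ℝ) : Prop :=
  openTotalVariation f a b < ⊤

/-- The essential variation `e-T_f ]a,b[`: the infimum of `T_g ]a,b[` over all `g` that are equal
to `f` almost everywhere in `]a,b[`. -/
noncomputable def essVariation (f : ℝ → ℝ) (a b : ℝ) : ℝ≥0∞ :=
  ⨅ (g : ℝ → ℝ) (_ : g =ᵐ[volume.restrict (Ioo a b)] f), openTotalVariation g a b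

/-- The total variation `T_{f_M} ]a,b[` of the restriction `f_M` of `f` to `]a,b[ - M`: the supremum
of `∑ |f (x i) - f (x (i - 1))|` over finite increasing sequences of points of `]a,b[ - M`. -/
noncomputable def totalVariationOff (f : ℝ → ℝ) (a b : ℝ) (M : Set ℝ) : ℝ≥0∞ :=
  eVariationOn f (Ioo a b \ M)

/-- Cesari's quantity `φ(f)`: the infimum of `T_{f_M} ]a,b[` over all subsets `M` of `]a,b[` of
Lebesgue measure `0`. -/
noncomputable def cesariVariation (f : ℝ → ℝ) (a b : ℝ) : ℝ≥0∞ :=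
  ⨅ (M : Set ℝ) (_ : M ⊆ Ioo a b) (_ : volume M = 0), totalVariationOff f a b M

/-- The integral of `φ` with respect to a signed measure `μ`, through the Jordan decomposition
`μ = μ⁺ - μ⁻`. -/
noncomputable def signedIntegral {X : Type*} [MeasurableSpace X] (μ : SignedMeasure X)
    (φ : X → ℝ) : ℝ :=
  ∫ x, φ x ∂μ.toJordanDecomposition.posPart - ∫ x, φ x ∂μ.toJordanDecomposition.negPart

/-- The distributional derivative of `f` in `]a,b[` is represented by the finite signed measure
`μ` on the Borel sets of `]a,b[`. A `SignedMeasure` is real valued, hence `μ⁺` and `μ⁻` are finite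
Borel measures, automatically regular on the locally compact, second countable metric space
`]a,b[`, and `|μ| ]a,b[` is finite. -/
def HasDistribDerivMeasure (f : ℝ → ℝ) (a b : ℝ) (μ : SignedMeasure (Ioo a b)) : Prop :=
  ∀ φ : ℝ → ℝ, ContDiff ℝ ∞ φ → HasCompactSupport φ → tsupport φ ⊆ Ioo a b →
    ∫ x in Ioo a b, f x * deriv φ x = - signedIntegral μ (fun x : Ioo a b => φ x)

/-- `f ∈ BVL¹ ]a,b[`: `f` is integrable in `]a,b[` and its distributional derivative is a finite
signed Radon measure in `]a,b[`. -/
def MemBVL1 (f : ℝ → ℝ) (a b : ℝ) : Prop :=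
  IntegrableOn f (Ioo a b) ∧ ∃ μ : SignedMeasure (Ioo a b), HasDistribDerivMeasure f a b μ

/-! Write Df as the difference of two finite measures and let P, N be their distribution functions.
By Fubini, P - N has distributional derivative Df, so by the du Bois-Reymond lemma f = c + P - N
almost everywhere. The right-hand side g is right continuous and, being a constant plus a difference
of bounded monotone functions, of bounded variation. Right continuity makes g optimal: a partition
shifted slightly to the right can avoid both M and the null set where g and f differ, so T_g ≤
T_{f_M} for every null M. Conversely, any competitor h = f a.e. gives the null set M = {h ≠ f}, on
whose complement f is h, so φ(f) ≤ T_h. Thus e-T_f ≤ T_g ≤ φ(f) ≤ e-T_f. -/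

open Filter Topology

/-! ### Distribution functions of finite measures -/

/-- Integration by parts against the distribution function of a finite measure. -/
theorem integral_measureReal_Iic_mul_deriv (ν : Measure ℝ) [IsFiniteMeasure ν] {φ : ℝ → ℝ}
    (hφ : ContDiff ℝ 1 φ) (hc : HasCompactSupport φ) :
    ∫ x, ν.real (Iic x) * deriv φ x = -∫ y, φ y ∂ν := by
  have hmeas : MeasurableSet {p : ℝ × ℝ | p.2 ≤ p.1} :=
    measurableSet_le measurable_snd measurable_fst
  have hd : Integrable (deriv φ) :=
    (hφ.continuous_deriv le_rfl).integrable_of_hasCompactSupport hc.deriv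
  have hint : Integrable (Function.uncurry fun x y : ℝ => (Ici y).indicator (deriv φ) x)
      (volume.prod ν) := by
    have h := (hd.comp_fst ν).indicator hmeas
    refine h.congr (Eventually.of_forall fun p => ?_)
    simp [Function.uncurry, indicator_apply]
  calc ∫ x, ν.real (Iic x) * deriv φ x
      = ∫ x, (∫ y, (Ici y).indicator (deriv φ) x ∂ν) := by
        refine integral_congr_ae (Eventually.of_forall fun x => ?_)
        have : (fun y => (Ici y).indicator (deriv φ) x) =
            (Iic x).indicator fun _ => deriv φ x := by
          ext y; simp [indicator_apply]
        simp only [this]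
        rw [integral_indicator_const _ measurableSet_Iic, smul_eq_mul]
    _ = ∫ y, (∫ x, (Ici y).indicator (deriv φ) x) ∂ν := integral_integral_swap hint
    _ = ∫ y, -φ y ∂ν := by
        refine integral_congr_ae (Eventually.of_forall fun y => ?_)
        simp only
        rw [integral_indicator measurableSet_Ici, integral_Ici_eq_integral_Ioi,
          hc.integral_Ioi_deriv_eq hφ]
    _ = -∫ y, φ y ∂ν := integral_neg _

/-- Continuity from above of a finite measure; the closed half-line is what makes the distribution
function continuous from the right. -/
theorem continuousWithinAt_measureReal_Iic (ν : Measure ℝ) [IsFiniteMeasure ν] (x : ℝ) :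
    ContinuousWithinAt (fun x => ν.real (Iic x)) (Ioi x) x := by
  have h := tendsto_measure_biInter_gt (μ := ν) (s := fun r : ℝ => Iic r) (a := x)
    (fun r _ => measurableSet_Iic.nullMeasurableSet)
    (fun i j _ hij => Iic_subset_Iic.2 hij) ⟨x + 1, by simp, measure_ne_top _ _⟩
  have hI : (⋂ r > x, Iic r) = Iic x := by
    ext y
    simp only [mem_iInter, mem_Iic]
    exact ⟨fun h => le_of_forall_gt_imp_ge_of_dense h, fun h r hr => h.trans hr.le⟩
  rw [hI] at h
  exact (ENNReal.tendsto_toReal (measure_ne_top _ _)).comp h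

theorem monotone_measureReal_Iic (ν : Measure ℝ) [IsFiniteMeasure ν] :
    Monotone fun x => ν.real (Iic x) :=
  fun _ _ h => measureReal_mono (Iic_subset_Iic.2 h)

/-! ### Functions with vanishing distributional derivative -/

/-- A test function on an open interval with vanishing integral is the derivative of a test
function. -/
theorem exists_testFunction_deriv_eq {a b : ℝ} {ψ : ℝ → ℝ}
    (hψ : ContDiff ℝ ∞ ψ) (hc : HasCompactSupport ψ) (hs : tsupport ψ ⊆ Ioo a b)
    (h0 : ∫ x, ψ x = 0) :
    ∃ φ : ℝ → ℝ, ContDiff ℝ ∞ φ ∧ HasCompactSupport φ ∧ tsupport φ ⊆ Ioo a b ∧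
      deriv φ = ψ := by
  have hd : ∀ x, HasDerivAt (fun x => ∫ t in a..x, ψ t) (ψ x) x := fun x =>
    intervalIntegral.integral_hasDerivAt_right (hψ.continuous.intervalIntegrable _ _)
      hψ.continuous.stronglyMeasurable.stronglyMeasurableAtFilter hψ.continuous.continuousAt
  have hderiv : deriv (fun x => ∫ t in a..x, ψ t) = ψ := funext fun x => (hd x).deriv
  obtain ⟨c, d, hac, hdb, hcd⟩ : ∃ c d, a < c ∧ d < b ∧ tsupport ψ ⊆ Icc c d := by
    rcases (tsupport ψ).eq_empty_or_nonempty with he | hne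
    -- Here `c ≤ d` may fail; it is not needed.
    · exact ⟨a + 1, b - 1, by linarith, by linarith, by simp [he]⟩
    · have hK : IsCompact (tsupport ψ) := hc
      exact ⟨sInf (tsupport ψ), sSup (tsupport ψ), (hs (hK.sInf_mem hne)).1,
        (hs (hK.sSup_mem hne)).2,
        fun x hx => ⟨csInf_le hK.bddBelow hx, le_csSup hK.bddAbove hx⟩⟩
  have hz : ∀ x, x ∉ Icc c d → ψ x = 0 := fun x hx =>
    image_eq_zero_of_notMem_tsupport fun h => hx (hcd h)
  have hsup : Function.support (fun x => ∫ t in a..x, ψ t) ⊆ Icc c d := by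
    intro x hx
    by_contra hxc
    apply hx
    rcases lt_or_ge x c with h | h
    · refine intervalIntegral.integral_zero_ae (Eventually.of_forall fun t ht => hz t fun h' => ?_)
      have := ht.2
      rcases le_max_iff.1 this with h2 | h2 <;> linarith [h'.1]
    · have hdx : d < x := by
        by_contra hh
        exact hxc ⟨h, not_lt.1 hh⟩
      simp only
      rw [intervalIntegral.integral_eq_integral_of_support_subset, h0]
      intro t ht
      by_contra htt
      refine ht (hz t fun h' => htt ⟨by linarith [h'.1], by linarith [h'.2]⟩)
  have hts := closure_minimal hsup isClosed_Icc
  refine ⟨fun x => ∫ t in a..x, ψ t, ?_, ?_, ?_, hderiv⟩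
  · rw [contDiff_infty_iff_deriv]
    exact ⟨fun x => (hd x).differentiableAt, by rwa [hderiv]⟩
  · exact isCompact_Icc.of_isClosed_subset (isClosed_tsupport _) hts
  · exact hts.trans fun x hx => ⟨hac.trans_le hx.1, hx.2.trans_lt hdb⟩

/-- The du Bois-Reymond lemma on a bounded open interval. -/
theorem ae_eq_const_of_forall_integral_mul_deriv_eq_zero {a b : ℝ} (hab : a < b) {w : ℝ → ℝ}
    (hw : IntegrableOn w (Ioo a b))
    (h : ∀ φ : ℝ → ℝ, ContDiff ℝ ∞ φ → HasCompactSupport φ → tsupport φ ⊆ Ioo a b →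
      ∫ x in Ioo a b, w x * deriv φ x = 0) :
    ∃ c : ℝ, ∀ᵐ x, x ∈ Ioo a b → w x = c := by
  have hmul : ∀ φ : ℝ → ℝ, Continuous φ → HasCompactSupport φ →
      IntegrableOn (fun x => w x * φ x) (Ioo a b) := by
    intro φ hφ hc
    obtain ⟨C, hC⟩ := hc.exists_bound_of_continuous hφ
    exact hw.mul_bdd (c := C) hφ.aestronglyMeasurable (Eventually.of_forall hC)
  have hset : ∀ φ : ℝ → ℝ, tsupport φ ⊆ Ioo a b → ∫ x in Ioo a b, φ x = ∫ x, φ x :=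
    fun φ hs => setIntegral_eq_integral_of_forall_compl_eq_zero fun x hx =>
      image_eq_zero_of_notMem_tsupport fun h => hx (hs h)
  -- With η of unit mass, ψ - (∫ψ)η has integral zero, hence is the derivative of a test function.
  -- Testing w against it gives ∫wψ = c∫ψ with c = ∫wη.
  obtain ⟨η, hηs, hηc, hη, hη1⟩ : ∃ η : ℝ → ℝ, tsupport η ⊆ Ioo a b ∧ HasCompactSupport η ∧
      ContDiff ℝ ∞ η ∧ ∫ x, η x = 1 := by
    obtain ⟨g, hgs, hgc, hg, hgr, hg1⟩ := exists_contDiff_tsupport_subset (n := ⊤)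
      (Ioo_mem_nhds (show a < (a + b) / 2 by linarith) (show (a + b) / 2 < b by linarith))
    have hpos : 0 < ∫ x, g x := hg.continuous.integral_pos_of_hasCompactSupport_nonneg_nonzero hgc
      (fun x => (hgr ⟨x, rfl⟩).1) (x := (a + b) / 2) (by rw [hg1]; exact one_ne_zero)
    refine ⟨fun x => (∫ y, g y)⁻¹ * g x, (tsupport_mul_subset_right).trans hgs, hgc.mul_left,
      contDiff_const.mul hg, ?_⟩
    rw [integral_const_mul, inv_mul_cancel₀ hpos.ne']
  refine ⟨∫ x in Ioo a b, w x * η x, ?_⟩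
  set c := ∫ x in Ioo a b, w x * η x with hcdef
  have key : ∀ᵐ x, x ∈ Ioo a b → w x - c = 0 := by
    refine isOpen_Ioo.ae_eq_zero_of_integral_contDiff_smul_eq_zero ?_ ?_
    · exact (hw.sub (integrableOn_const (by simp))).locallyIntegrableOn
    · intro ψ hψ hψc hψs
      have hηi := hη.continuous.integrable_of_hasCompactSupport (μ := volume) hηc
      have hψi := hψ.continuous.integrable_of_hasCompactSupport (μ := volume) hψc
      have hcη : HasCompactSupport fun x => (∫ y, ψ y) * η x := hηc.mul_left
      obtain ⟨φ, hφ, hφc, hφs, hφd⟩ := exists_testFunction_deriv_eq (a := a) (b := b)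
        (ψ := fun x => ψ x - (∫ y, ψ y) * η x)
        (hψ.sub (contDiff_const.mul hη)) (hψc.sub hcη)
        ((tsupport_sub ψ _).trans (union_subset hψs
          ((tsupport_mul_subset_right).trans hηs)))
        (by rw [integral_sub hψi (hηi.const_mul _), integral_const_mul, hη1]; ring)
      have h1 := h φ hφ hφc hφs
      rw [hφd] at h1
      have h2 : ∫ x in Ioo a b, w x * (ψ x - (∫ y, ψ y) * η x) =
          (∫ x in Ioo a b, w x * ψ x) - (∫ y, ψ y) * c := by
        rw [hcdef, ← integral_const_mul, ← integral_sub (hmul ψ hψ.continuous hψc)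
          ((hmul η hη.continuous hηc).const_mul _)]
        congr 1; ext x; ring
      have h3 : ∫ x, ψ x • (w x - c) = ∫ x in Ioo a b, ψ x • (w x - c) :=
        (setIntegral_eq_integral_of_forall_compl_eq_zero fun x hx => by
          rw [image_eq_zero_of_notMem_tsupport fun h => hx (hψs h), zero_smul]).symm
      have h4 : ∫ x in Ioo a b, ψ x • (w x - c) =
          (∫ x in Ioo a b, w x * ψ x) - c * ∫ x in Ioo a b, ψ x := by
        rw [← integral_const_mul, ← integral_sub (hmul ψ hψ.continuous hψc)
          (hψi.integrableOn.const_mul _)]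
        congr 1; ext x; rw [smul_eq_mul]; ring
      rw [h3, h4, hset ψ hψs]
      linarith
  filter_upwards [key] with x hx hxm using sub_eq_zero.1 (hx hxm)

/-! ### The right continuous representative -/

theorem eVariationOn_sub_le (f g : ℝ → ℝ) (s : Set ℝ) :
    eVariationOn (fun x => f x - g x) s ≤ eVariationOn f s + eVariationOn g s := by
  refine iSup_le ?_
  rintro ⟨n, u, hu, hus⟩
  calc ∑ i ∈ Finset.range n, edist (f (u (i + 1)) - g (u (i + 1))) (f (u i) - g (u i))
      ≤ ∑ i ∈ Finset.range n,
          (edist (f (u (i + 1))) (f (u i)) + edist (g (u (i + 1))) (g (u i))) := by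
        refine Finset.sum_le_sum fun i _ => ?_
        simp only [edist_dist]
        rw [← ENNReal.ofReal_add dist_nonneg dist_nonneg]
        exact ENNReal.ofReal_le_ofReal (dist_sub_sub_le _ _ _ _)
    _ ≤ eVariationOn f s + eVariationOn g s := by
        rw [Finset.sum_add_distrib]
        exact add_le_add (eVariationOn.sum_le hu hus) (eVariationOn.sum_le hu hus)

/-- A function in `BVL¹` has a right continuous representative of bounded variation. -/
theorem MemBVL1.exists_rightContinuous_memBVOpen {f : ℝ → ℝ} {a b : ℝ} (hab : a < b)
    (hf : MemBVL1 f a b) :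
    ∃ g : ℝ → ℝ, MemBVOpen g a b ∧ g =ᵐ[volume.restrict (Ioo a b)] f ∧
      ∀ x, ContinuousWithinAt g (Ioi x) x := by
  obtain ⟨hfi, μ, hμ⟩ := hf
  -- Pushing forward to ℝ keeps the measures finite, so P and N are bounded and monotone on all of
  -- ℝ, in particular on the closed interval [a,b].
  set νp := μ.toJordanDecomposition.posPart.map ((↑) : Ioo a b → ℝ) with hνp
  set νn := μ.toJordanDecomposition.negPart.map ((↑) : Ioo a b → ℝ) with hνn
  have hemb : MeasurableEmbedding ((↑) : Ioo a b → ℝ) :=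
    MeasurableEmbedding.subtype_coe measurableSet_Ioo
  set P : ℝ → ℝ := fun x => νp.real (Iic x)
  set N : ℝ → ℝ := fun x => νn.real (Iic x)
  have hPm : Monotone P := monotone_measureReal_Iic νp
  have hNm : Monotone N := monotone_measureReal_Iic νn
  have hint : ∀ F : ℝ → ℝ, Monotone F → IntegrableOn F (Ioo a b) := fun F hF =>
    ((hF.monotoneOn (Icc a b)).integrableOn_isCompact isCompact_Icc).mono_set Ioo_subset_Icc_self
  obtain ⟨c, hc⟩ := ae_eq_const_of_forall_integral_mul_deriv_eq_zero hab
    (w := fun x => f x - (P x - N x)) (hfi.sub ((hint P hPm).sub (hint N hNm))) (by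
      intro φ hφ hφc hφs
      have hφ1 : ContDiff ℝ 1 φ := hφ.of_le (by norm_cast)
      have hdc : Continuous (deriv φ) := hφ1.continuous_deriv le_rfl
      obtain ⟨C, hC⟩ := hφc.deriv.exists_bound_of_continuous hdc
      have hmul : ∀ F : ℝ → ℝ, IntegrableOn F (Ioo a b) →
          IntegrableOn (fun x => F x * deriv φ x) (Ioo a b) := fun F hF =>
        hF.mul_bdd (c := C) hdc.aestronglyMeasurable (Eventually.of_forall hC)
      have hset : ∀ F : ℝ → ℝ, ∫ x in Ioo a b, F x * deriv φ x = ∫ x, F x * deriv φ x :=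
        fun F => setIntegral_eq_integral_of_forall_compl_eq_zero fun x hx => by
          rw [image_eq_zero_of_notMem_tsupport fun h => hx (hφs (tsupport_deriv_subset h)),
            mul_zero]
      have hfφ := hμ φ hφ hφc hφs
      have hPφ := integral_measureReal_Iic_mul_deriv νp hφ1 hφc
      have hNφ := integral_measureReal_Iic_mul_deriv νn hφ1 hφc
      rw [← hset, hνp, hemb.integral_map, ← hνp] at hPφ
      rw [← hset, hνn, hemb.integral_map, ← hνn] at hNφ
      have hsplit : ∫ x in Ioo a b, (f x - (P x - N x)) * deriv φ x =
          (∫ x in Ioo a b, f x * deriv φ x) - ((∫ x in Ioo a b, P x * deriv φ x) -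
            ∫ x in Ioo a b, N x * deriv φ x) := by
        rw [← integral_sub (hmul P (hint P hPm)) (hmul N (hint N hNm)),
          ← integral_sub (g := fun x => P x * deriv φ x - N x * deriv φ x) (hmul f hfi)
            ((hmul P (hint P hPm)).sub (hmul N (hint N hNm)))]
        congr 1; ext x; ring
      rw [hsplit, hfφ, signedIntegral]
      linarith)
  refine ⟨fun x => c + (P x - N x), ?_, ?_, ?_⟩
  · have hmono : ∀ F : ℝ → ℝ, Monotone F → eVariationOn F (Icc a b) < ⊤ := fun F hF => by
      have h := (hF.monotoneOn univ).locallyBoundedVariationOn a b trivial trivial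
      rw [univ_inter] at h
      exact lt_top_iff_ne_top.2 h
    have hbv : eVariationOn (fun x => c + (P x - N x)) (Icc a b) < ⊤ := by
      have heq : eVariationOn (fun x => c + (P x - N x)) (Icc a b) =
          eVariationOn (fun x => P x - N x) (Icc a b) := by
        simp [eVariationOn]
      rw [heq]
      exact (eVariationOn_sub_le P N _).trans_lt
        (ENNReal.add_lt_top.2 ⟨hmono P hPm, hmono N hNm⟩)
    refine lt_of_le_of_lt ?_ hbv
    exact iSup₂_le fun c' d => iSup_le fun h1 => iSup_le fun _ => iSup_le fun h3 =>
      eVariationOn.mono _ (Icc_subset_Icc h1.le h3.le)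
  · rw [EventuallyEq, ae_restrict_iff' measurableSet_Ioo]
    filter_upwards [hc] with x hx hxm
    linarith [hx hxm]
  · exact fun x => continuousWithinAt_const.add
      ((continuousWithinAt_measureReal_Iic νp x).sub (continuousWithinAt_measureReal_Iic νn x))

/-! ### Comparison of the variations -/

/-- The total variation of a right continuous function is not larger than the total variation of
the restriction of an almost everywhere equal function to the complement of a null set. -/
theorem openTotalVariation_le_totalVariationOff {f g : ℝ → ℝ} {a b : ℝ} {M : Set ℝ}
    (hg : ∀ x, ContinuousWithinAt g (Ioi x) x) (hgf : g =ᵐ[volume.restrict (Ioo a b)] f)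
    (hM : volume M = 0) : openTotalVariation g a b ≤ totalVariationOff f a b M := by
  refine iSup₂_le fun c d => iSup_le fun hac => iSup_le fun hcd => iSup_le fun hdb => ?_
  refine iSup_le ?_
  rintro ⟨n, u, hu, hus⟩
  have hlim : ∀ x : ℝ, Tendsto (fun t => g (x + t)) (𝓝[>] 0) (𝓝 (g x)) := by
    intro x
    refine Tendsto.comp (hg x) (tendsto_nhdsWithin_iff.2 ⟨?_, ?_⟩)
    · have : Tendsto (fun t : ℝ => x + t) (𝓝 0) (𝓝 (x + 0)) :=
        (continuous_const_add x).tendsto 0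
      rw [add_zero] at this
      exact this.mono_left nhdsWithin_le_nhds
    · filter_upwards [self_mem_nhdsWithin] with t ht
      simpa using ht
  have hsum : Tendsto (fun t => ∑ i ∈ Finset.range n, edist (g (u (i + 1) + t)) (g (u i + t)))
      (𝓝[>] 0) (𝓝 (∑ i ∈ Finset.range n, edist (g (u (i + 1))) (g (u i)))) :=
    tendsto_finsetSum _ fun i _ => (hlim _).edist (hlim _)
  have hae : ∀ᵐ t : ℝ, ∀ i, u i + t ∉ M ∧ (u i + t ∈ Ioo a b → g (u i + t) = f (u i + t)) := by
    refine ae_all_iff.2 fun i => ?_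
    have h1 : ∀ᵐ y : ℝ, y ∉ M ∧ (y ∈ Ioo a b → g y = f y) :=
      (measure_eq_zero_iff_ae_notMem.1 hM).and ((ae_restrict_iff' measurableSet_Ioo).1 hgf)
    exact (measurePreserving_add_left volume (u i)).quasiMeasurePreserving.ae h1
  -- Almost every t is good and each ]0,ε[ has positive measure, so good shifts accumulate at 0.
  have hfreq : ∃ᶠ t in 𝓝[>] (0 : ℝ),
      ∀ i, u i + t ∉ M ∧ (u i + t ∈ Ioo a b → g (u i + t) = f (u i + t)) := by
    intro hev
    obtain ⟨ε, hε, hsub⟩ := mem_nhdsGT_iff_exists_Ioo_subset.1 hev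
    have h0 : volume (Ioo (0 : ℝ) ε) = 0 := measure_mono_null hsub (by
      rw [ae_iff] at hae
      exact hae)
    rw [Real.volume_Ioo, ENNReal.ofReal_eq_zero] at h0
    have : (0 : ℝ) < ε := hε
    linarith
  refine le_of_tendsto_of_frequently hsum ?_
  -- Shifts t < b - d keep the points of [c,d] inside ]a,b[.
  refine (hfreq.and_eventually (Ioo_mem_nhdsGT (sub_pos.2 hdb))).mono ?_
  rintro t ⟨ht, ht0, htb⟩
  have hmem : ∀ i, u i + t ∈ Ioo a b := fun i =>
    ⟨by linarith [(hus i).1], by linarith [(hus i).2]⟩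
  simp only [fun i => (ht i).2 (hmem i)]
  exact eVariationOn.sum_le (f := f) (u := fun i => u i + t) (fun i j hij => by
    simpa using hu hij) fun i => ⟨hmem i, (ht i).1⟩

theorem eVariationOn_Ioo_le_openTotalVariation (g : ℝ → ℝ) (a b : ℝ) :
    eVariationOn g (Ioo a b) ≤ openTotalVariation g a b := by
  refine iSup_le ?_
  rintro ⟨n, u, hu, hus⟩
  -- Midpoints keep the enclosing interval nondegenerate even when `u 0 = u n`.
  have hc : (a + u 0) / 2 < u 0 := by linarith [(hus 0).1]
  have hd : u n < (u n + b) / 2 := by linarith [(hus n).2]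
  have h0n : u 0 ≤ u n := hu (Nat.zero_le n)
  calc ∑ i ∈ Finset.range n, edist (g (u (i + 1))) (g (u i))
      ≤ eVariationOn g (Icc ((a + u 0) / 2) ((u n + b) / 2)) :=
        eVariationOn.sum_le_of_monotoneOn_Iic (hu.monotoneOn _) fun i hi =>
          ⟨hc.le.trans (hu (Nat.zero_le i)), (hu hi).trans hd.le⟩
    _ ≤ openTotalVariation g a b := by
        refine le_iSup₂_of_le ((a + u 0) / 2) ((u n + b) / 2) ?_
        refine le_iSup_of_le (by linarith [(hus 0).1]) (le_iSup_of_le (by linarith)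
          (le_iSup_of_le (by linarith [(hus n).2]) le_rfl))

theorem cesariVariation_le_essVariation (f : ℝ → ℝ) (a b : ℝ) :
    cesariVariation f a b ≤ essVariation f a b := by
  refine le_iInf₂ fun g hg => ?_
  have hnull : volume {x ∈ Ioo a b | g x ≠ f x} = 0 := by
    have h := (ae_restrict_iff' measurableSet_Ioo).1 hg
    rw [ae_iff] at h
    simpa only [Classical.not_imp] using h
  refine iInf₂_le_of_le _ (sep_subset _ _) (iInf_le_of_le hnull ?_)
  calc totalVariationOff f a b {x ∈ Ioo a b | g x ≠ f x}
      = eVariationOn g (Ioo a b \ {x ∈ Ioo a b | g x ≠ f x}) :=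
        eVariationOn.congr fun x hx => by
          by_contra hne
          exact hx.2 ⟨hx.1, fun h => hne h.symm⟩
    _ ≤ eVariationOn g (Ioo a b) := eVariationOn.mono _ sdiff_subset
    _ ≤ openTotalVariation g a b := eVariationOn_Ioo_le_openTotalVariation g a b

theorem mainTheorem7 (a b : ℝ) (hab : a < b) (f : ℝ → ℝ) (hf : MemBVL1 f a b) :
    essVariation f a b = cesariVariation f a b ∧
    ∃ g : ℝ → ℝ, MemBVOpen g a b ∧ g =ᵐ[volume.restrict (Ioo a b)] f ∧
      cesariVariation f a b = openTotalVariation g a b := by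
  obtain ⟨g, hgbv, hgf, hgc⟩ := hf.exists_rightContinuous_memBVOpen hab
  have h1 : openTotalVariation g a b ≤ cesariVariation f a b :=
    le_iInf₂ fun M _ => le_iInf fun hM => openTotalVariation_le_totalVariationOff hgc hgf hM
  have h2 : essVariation f a b ≤ openTotalVariation g a b := iInf₂_le g hgf
  have h3 := cesariVariation_le_essVariation f a b
  exact ⟨le_antisymm (h2.trans h1) h3, g, hgbv, hgf, le_antisymm (h3.trans h2) h1⟩
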